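/- Let $\Pi$ be a space of policies, $\mathcal{O}$ a space of observations and $H$ a non-negative integer. A model $M=(\mathsf{P}^M,\mathbf{R}^M)$ consists of a probability distribution $\mathsf{P}^M(\pi)$ on $\mathcal{O}$ for each $\pi\in\Pi$ and a mean reward function $\mathbf{R}^M=(R^M_h)_{h\le H}:\mathcal{O}\to[0,1]^H$. A reward distribution for $M$ is a conditional law of $\mathbf{r}\in\mathbb{R}^H$ given $o$ with conditionally independent entries and conditional mean $\mathbf{R}^M(o)$; one episode of $M$ under $\pi$ yields $o\sim\mathsf{P}^M(\pi)$ and then $\mathbf{r}$. Write $f^M(\pi)=\mathbb{E}_{o\sim\mathsf{P}^M(\pi)}[\sum_h R^M_h(o)]$, $f^M(\pi_M)=\sup_\pi f^M(\pi)$, $g^M(\pi)=f^M(\pi_M)-f^M(\pi)$, and $$D_{\mathrm{RL}}^2(M(\pi),\overline M(\pi))=D_{\mathrm H}^2(\mathsf{P}^M(\pi),\mathsf{P}^{\overline M}(\pi))+\mathbb{E}_{o\sim\mathsf{P}^M(\pi)}\big[\|\mathbf{R}^M(o)-\mathbf{R}^{\overline M}(o)\|_2^2\big],$$ where $D_{\mathrm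 H}^2(P,Q)=\int(\sqrt{dP/d\mu}-\sqrt{dQ/d\mu})^2d\mu$ for any measure $\mu$ dominating $P$ and $Q$. For a class $\mathcal{N}$ of models, a model $\overline M$ and $\gamma>0$, define $$\mathrm{edec}_\gamma(\mathcal{N},\overline M)=\inf_{p_{\mathrm{exp}},p_{\mathrm{out}}\in\Delta(\Pi)}\ \sup_{M\in\mathcal{N}}\ \Big\{\mathbb{E}_{\pi\sim p_{\mathrm{out}}}[g^M(\pi)]-\gamma\,\mathbb{E}_{\pi\sim p_{\mathrm{exp}}}\big[D_{\mathrm{RL}}^2(M(\pi),\overline M(\pi))\big]\Big\}.$$ An algorithm $\mathfrak{A}$ for $T$ episodes consists of rules that choose, for each $t\le T$, a distribution in $\Delta(\Pi)$ for the $t$-th policy given the policies, observations and reward vectors of the first $t-1$ episodes, and an output distribution $\hat p_{\mathrm{out}}\in\Delta(\Pi)$ given all $T$ episodes; under a model $M$, $\mathbf{SubOpt}=f^M(\pi_M)-\mathbb{E}_{\pi\sim\hat p_{\mathrm{out}}}[f^M(\pi)]$. Let $\mathcal{M}$ be a non-empty class of models and let $T\ge1$ be an integer. Put $$V(\mathcal{M})=3\sup_{M,\overline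 M\in\mathcal{M}}\ \sup_{\pi,o}\frac{\mathsf{P}^M(o\mid\pi)}{\mathsf{P}^{\overline M}(o\mid\pi)}\in[3,\infty],\qquad C(T)=2^{13}\log\big(\min\{2T,V(\mathcal{M})\}\big),\qquad \underline\epsilon_\gamma=\frac{\gamma}{C(T)\,T},$$ where, for general observation spaces, the inner supremum of density ratios means $\sup_{\pi,A}\mathsf{P}^M(\pi)(A)/\mathsf{P}^{\overline M}(\pi)(A)$ over measurable events $A$ (with $0/0=0$), and $$\mathcal{M}^\infty_\varepsilon(\overline M)=\{M\in\mathcal{M}:\ |g^M(\pi)-g^{\overline M}(\pi)|\le\varepsilon\ \text{ for all }\pi\in\Pi\}.$$ Then one can assign to each model in $\mathcal{M}$ a reward distribution with $\mathbf{r}\in[-2,2]^H$ almost surely such that for every algorithm $\mathfrak{A}$ for $T$ episodes there is a model $M\in\mathcal{M}$ with $$\mathbb{E}^{M,\mathfrak{A}}[\mathbf{SubOpt}]\ \ge\ \frac16\,\sup_{\gamma>0}\ \sup_{\overline M\in\mathcal{M}}\ \mathrm{edec}_\gamma\big(\mathcal{M}^\infty_{\underline\epsilon_\gamma}(\overline M),\overline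 M\big).$$ -/

import Mathlib

open MeasureTheory ProbabilityTheory
open scoped ENNReal

/-- A model of decision making with structured observations, with policies `Pol`, observations `Obs`
and reward vectors indexed by `Fin H`: the law of the observation under each policy, and the
conditional mean of the reward vector given the observation. -/
structure DMSOModel (Pol Obs : Type*) [MeasurableSpace Pol] [MeasurableSpace Obs] (H : ℕ) where
  /-- `obs π` is the law of the observation when `π` is executed. -/
  obs : Kernel Pol Obs
  obs_markov : IsMarkovKernel obs
  /-- `meanReward o h` is the mean of the `h`-th reward given the observation `o`. -/
  meanReward : Obs → Fin H → ℝ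
  measurable_meanReward : Measurable meanReward
  meanReward_mem : ∀ o h, meanReward o h ∈ Set.Icc (0 : ℝ) 1

attribute [instance] DMSOModel.obs_markov

/-- Squared Hellinger distance `∫ (√(dP/dμ) - √(dQ/dμ))² dμ`, computed with the dominating measure
`μ = P + Q` (the value does not depend on the dominating measure). -/
noncomputable def hellingerSq {X : Type*} [MeasurableSpace X] (P Q : Measure X) : ℝ :=
  ∫ x, (√(P.rnDeriv (P + Q) x).toReal - √(Q.rnDeriv (P + Q) x).toReal) ^ 2 ∂(P + Q)

namespace DMSOModel

variable {Pol Obs : Type*} [MeasurableSpace Pol] [MeasurableSpace Obs] {H : ℕ}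

/-- The value `f^M(π)`: expected cumulative reward of `π`. -/
noncomputable def value (M : DMSOModel Pol Obs H) (π : Pol) : ℝ :=
  ∫ o, ∑ h, M.meanReward o h ∂(M.obs π)

/-- The optimal value `f^M(π_M)`. -/
noncomputable def optValue (M : DMSOModel Pol Obs H) : ℝ := ⨆ π, M.value π

/-- The suboptimality gap `g^M(π) = f^M(π_M) - f^M(π)`. -/
noncomputable def gap (M : DMSOModel Pol Obs H) (π : Pol) : ℝ := M.optValue - M.value π

/-- The divergence `D_RL²(M(π), M'(π))`: squared Hellinger distance of the observation laws plus the
expected squared `L²` distance of the mean rewards, the expectation being under `M`. -/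
noncomputable def dRLSq (M M' : DMSOModel Pol Obs H) (π : Pol) : ℝ :=
  hellingerSq (M.obs π) (M'.obs π) +
    ∫ o, ∑ h, (M.meanReward o h - M'.meanReward o h) ^ 2 ∂(M.obs π)

/-- The explorative decision-estimation coefficient `edec_γ(𝓜, δ_{M'})` of the class `𝓜` with
respect to the point mass at the reference model `M'`. -/
noncomputable def edec (γ : ℝ) (𝓜 : Set (DMSOModel Pol Obs H)) (M' : DMSOModel Pol Obs H) : EReal :=
  ⨅ (pexp : ProbabilityMeasure Pol) (pout : ProbabilityMeasure Pol), ⨆ M ∈ 𝓜,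
    (((∫ π, M.gap π ∂(pout : Measure Pol)) -
      γ * ∫ π, M.dRLSq M' π ∂(pexp : Measure Pol) : ℝ) : EReal)

/-- The localization `𝓜^∞_ε(M')` of the class `𝓜` around `M'`. -/
def localized (𝓜 : Set (DMSOModel Pol Obs H)) (ε : ℝ) (M' : DMSOModel Pol Obs H) :
    Set (DMSOModel Pol Obs H) :=
  {M ∈ 𝓜 | ∀ π, |M.gap π - M'.gap π| ≤ ε}

/-- `V(𝓜)`: three times the largest likelihood ratio of observations between two models of the class
under the same policy (possibly `∞`). The supremum of the ratio of densities is expressed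
as the supremum of the ratio of probabilities of events, with `0 / 0 = 0` and `x / 0 = ∞` for
`x > 0`. -/
noncomputable def ratioBound (𝓜 : Set (DMSOModel Pol Obs H)) : ℝ≥0∞ :=
  3 * ⨆ (M ∈ 𝓜) (M' ∈ 𝓜) (π : Pol) (A : Set Obs) (_ : MeasurableSet A),
    M.obs π A / M'.obs π A

/-- `C(T) = 2¹³ log (2T ∧ V(𝓜))`. -/
noncomputable def logFactor (𝓜 : Set (DMSOModel Pol Obs H)) (T : ℕ) : ℝ :=
  2 ^ 13 * Real.log (min (2 * (T : ℝ≥0∞)) (ratioBound 𝓜)).toReal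

/-- The localization radius `γ / (C(T) T)`. -/
noncomputable def radius (𝓜 : Set (DMSOModel Pol Obs H)) (T : ℕ) (γ : ℝ) : ℝ :=
  γ / (logFactor 𝓜 T * T)

/-- A reward distribution for the model `M`: a conditional law of the reward vector given the
observation, with independent entries, whose conditional mean is the mean reward of `M`. -/
structure RewardLaw (M : DMSOModel Pol Obs H) where
  kernel : Kernel Obs (Fin H → ℝ)
  markov : IsMarkovKernel kernel
  indep : ∀ o, iIndepFun (fun (h : Fin H) (r : Fin H → ℝ) => r h) (kernel o)
  integrable : ∀ o h, Integrable (fun r : Fin H → ℝ => r h) (kernel o)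
  mean : ∀ o h, ∫ r, r h ∂(kernel o) = M.meanReward o h

attribute [instance] RewardLaw.markov

/-- The law of (observation, reward vector) under each policy. -/
noncomputable def outcome (M : DMSOModel Pol Obs H) (R : M.RewardLaw) :
    Kernel Pol (Obs × (Fin H → ℝ)) :=
  M.obs.compProd (R.kernel.prodMkLeft Pol)

instance (M : DMSOModel Pol Obs H) (R : M.RewardLaw) : IsMarkovKernel (M.outcome R) := by
  unfold outcome; infer_instance

end DMSOModel

/-- What the learner sees in one episode: the executed policy, the observation and the reward
vector. -/
abbrev Episode (Pol Obs : Type*) (H : ℕ) : Type _ := Pol × Obs × (Fin H → ℝ)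

/-- An algorithm interacting for `T` episodes: the policy of each episode is drawn from a law that
depends on the episodes before it, and after the last episode a law on policies is returned. -/
structure PACAlgorithm (Pol Obs : Type*) [MeasurableSpace Pol] [MeasurableSpace Obs] (H T : ℕ) where
  /-- `explore t _` is the rule for the episode that is preceded by exactly `t` episodes. -/
  explore : (t : ℕ) → t < T → Kernel (Fin t → Episode Pol Obs H) Pol
  explore_markov : ∀ t ht, IsMarkovKernel (explore t ht)
  /-- The rule for the output distribution. -/
  output : Kernel (Fin T → Episode Pol Obs H) Pol
  output_markov : IsMarkovKernel output

attribute [instance] PACAlgorithm.explore_markov PACAlgorithm.output_markov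

namespace PACAlgorithm

open DMSOModel

variable {Pol Obs : Type*} [MeasurableSpace Pol] [MeasurableSpace Obs] {H T : ℕ}

/-- The conditional law of the next episode given a history of `t` episodes. -/
noncomputable def step (A : PACAlgorithm Pol Obs H T) (M : DMSOModel Pol Obs H) (R : M.RewardLaw)
    (t : ℕ) (ht : t < T) : Kernel (Fin t → Episode Pol Obs H) (Episode Pol Obs H) :=
  (A.explore t ht).compProd ((M.outcome R).prodMkLeft (Fin t → Episode Pol Obs H))

instance (A : PACAlgorithm Pol Obs H T) (M : DMSOModel Pol Obs H) (R : M.RewardLaw) (t : ℕ)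
    (ht : t < T) : IsMarkovKernel (A.step M R t ht) := by
  unfold step; infer_instance

/-- The law of the first `t` episodes when the algorithm interacts with the model `M` whose rewards
have the conditional law `R`. -/
noncomputable def historyLaw (A : PACAlgorithm Pol Obs H T) (M : DMSOModel Pol Obs H)
    (R : M.RewardLaw) : (t : ℕ) → t ≤ T → Measure (Fin t → Episode Pol Obs H)
  | 0, _ => Measure.dirac Fin.elim0
  | t + 1, ht =>
      ((historyLaw A M R t (Nat.le_of_succ_le ht)).compProd (A.step M R t ht)).map
        (fun p => Fin.snoc (α := fun _ => Episode Pol Obs H) p.1 p.2)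

/-- The suboptimality `f^M(π_M) - E_{π ∼ p} f^M(π)` of an output distribution `p`. -/
noncomputable def subOpt (M : DMSOModel Pol Obs H) (p : Measure Pol) : ℝ :=
  M.optValue - ∫ π, M.value π ∂p

/-- The expected suboptimality of the output of the algorithm when it interacts with `M`. -/
noncomputable def expectedSubOpt (A : PACAlgorithm Pol Obs H T) (M : DMSOModel Pol Obs H)
    (R : M.RewardLaw) : ℝ :=
  ∫ hist, subOpt M (A.output hist) ∂(A.historyLaw M R T le_rfl)

end PACAlgorithm

/-!
The rewards are independent variables on `{-2, 2}` (`DMSOModel.coinReward`): for these the squared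
Hellinger distance of two reward laws is at most the squared distance of the mean vectors
(`sum_sq_sqrt_signWeight_sub_le`), so that one episode of `M` and one of `M'` are as hard to tell
apart as `dRLSq M M'` says.

Fix an algorithm and a reference model `M'`, play the coefficient with the average exploration law
and the average output law of the algorithm under `M'`, and let `M` be a model of the localized
class that witnesses the value of the coefficient. Two facts give the bound.

* Telling the interactions with `M` and `M'` apart costs at most the sum over the episodes of the
  expected `dRLSq M M'` under `M'`, without any logarithm
  (`PACAlgorithm.sub_sum_dRLSq_le_historyLaw_mixture`). The argument uses the family of divergences
  `inf_f (∫ (1 - f)² dP' + l ∫ f² dP)`, `l ≥ 0`, instead of the Hellinger distance. For densities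
  `p'` and `p` the infimum is `∫ l p p' / (p' + l p)`, and subtracting the tangent at `p = p'` leaves
  an error which is at most `2 (√p' - √p)²` *uniformly in `l`* (`tangent_sub_sq_le_mixture`). In the
  induction over the episodes `l` is multiplied by the likelihood ratio of the history, and the
  uniformity keeps the error under `M'`. Everything is phrased with test functions `f`, so no
  likelihood ratio of histories occurs. Since the logarithm in the radius is at least `log 2`, this
  is more than enough.

* The difference of the suboptimalities of the output for `M` and `M'` is at most the radius of the
  localization. If the algorithm were good for both models, the positive part of this difference
  would have a large expectation under `M'` and a small one under `M`, more than their
  indistinguishability allows (`PACAlgorithm.le_expectedSubOpt_or`).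

The second fact gives the constant `1 / 5`. The room between `1 / 5` and `1 / 6` is used because the
supremum over the reference models need not be attained.
-/

/-! ### Pointwise inequalities -/

/-- For the densities `a ^ 2` and `b ^ 2`, the left side is the tangent at `a = b` of the minimum of
the right side over `f`, minus an error that does not depend on `l`. -/
theorem tangent_sub_sq_le_mixture {l a b : ℝ} (hl : 0 ≤ l) (f : ℝ) :
    (l ^ 2 * a ^ 2 + l * b ^ 2) / (1 + l) ^ 2 - 2 * (a - b) ^ 2 ≤
      a ^ 2 * (1 - f) ^ 2 + l * (b ^ 2 * f ^ 2) := by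
  have hl1 : 0 < (1 + l) ^ 2 := by positivity
  have hD : 0 ≤ a ^ 2 + l * b ^ 2 := by positivity
  rcases hD.eq_or_lt with hD | hD
  · have h1 : a ^ 2 = 0 := by nlinarith [sq_nonneg a, mul_nonneg hl (sq_nonneg b)]
    have h2 : l * b ^ 2 = 0 := by linarith
    have h3 : l ^ 2 * a ^ 2 + l * b ^ 2 = 0 := by rw [h1, h2]; ring
    rw [h3, zero_div]
    have : 0 ≤ a ^ 2 * (1 - f) ^ 2 + l * (b ^ 2 * f ^ 2) := by positivity
    nlinarith [sq_nonneg (a - b)]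
  · have key : l ^ 2 * (a + b) ^ 2 ≤ 2 * ((1 + l) ^ 2 * (a ^ 2 + l * b ^ 2)) := by
      have e1 : l ^ 2 * (a + b) ^ 2 ≤ l ^ 2 * (2 * (a ^ 2 + b ^ 2)) := by
        gcongr; nlinarith [sq_nonneg (a - b)]
      have e2 : 0 ≤ (1 + 2 * l) * a ^ 2 + (l + l ^ 2 + l ^ 3) * b ^ 2 := by positivity
      nlinarith
    have h1 : l * a ^ 2 * b ^ 2 / (a ^ 2 + l * b ^ 2) ≤
        a ^ 2 * (1 - f) ^ 2 + l * (b ^ 2 * f ^ 2) := by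
      rw [div_le_iff₀ hD]
      nlinarith [sq_nonneg ((a ^ 2 + l * b ^ 2) * f - a ^ 2)]
    refine le_trans ?_ h1
    rw [sub_le_iff_le_add, div_add' _ _ _ hD.ne', div_le_div_iff₀ hl1 hD]
    nlinarith [mul_le_mul_of_nonneg_right key (sq_nonneg (a - b))]

/-- If the inequality holds for every multiplier `l`, then it holds for the optimal one,
`l = (1 - F) / F` (a limit when `F = 0`). -/
theorem one_sub_sq_le_of_forall_multiplier {c F : ℝ} (hF0 : 0 ≤ F) (hF1 : F ≤ 1)
    (h : ∀ l : ℝ, 0 ≤ l → l / (1 + l) ≤ c + l * F ^ 2) : (1 - F) ^ 2 ≤ c := by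
  rcases hF0.eq_or_lt with rfl | hF
  · by_contra! hc
    have hc0 : 0 ≤ c := by simpa using h 0 le_rfl
    have hc1 : c < 1 := by simpa using hc
    have h2 := h (1 / (1 - c)) (by have : 0 < 1 - c := by linarith
                                   positivity)
    have h3 : 0 < 1 - c := by linarith
    have h4 : 1 / (1 - c) / (1 + 1 / (1 - c)) = 1 / (2 - c) := by
      have : 2 - c ≠ 0 := by linarith
      have : 1 - c + 1 ≠ 0 := by linarith
      field_simp
      ring
    rw [h4, div_le_iff₀ (by linarith)] at h2
    nlinarith
  · have h2 := h ((1 - F) / F) (div_nonneg (by linarith) hF0)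
    have h4 : (1 - F) / F / (1 + (1 - F) / F) = 1 - F := by field_simp; ring
    have h5 : (1 - F) / F * F ^ 2 = (1 - F) * F := by field_simp
    rw [h4, h5] at h2
    nlinarith

/-! ### Two-point rewards -/

/-- The probability that a reward with mean `x`, supported on the two points `2` (for `true`) and
`-2` (for `false`), gives to each of them. -/
noncomputable def coinWeight (x : ℝ) (b : Bool) : ℝ := if b then (2 + x) / 4 else (2 - x) / 4

/-- The two possible values of a reward. -/
def coinValue (b : Bool) : ℝ := if b then 2 else -2

/-- The law on `{-2, 2}` with mean `x`, for `x ∈ [-2, 2]`. -/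
noncomputable def coinMeasure (x : ℝ) : Measure ℝ :=
  ∑ b, ENNReal.ofReal (coinWeight x b) • Measure.dirac (coinValue b)

/-- The probability of the reward vector with signs `s` when the rewards are independent two-point
variables with means `x h`. -/
noncomputable def signWeight {H : ℕ} (x : Fin H → ℝ) (s : Fin H → Bool) : ℝ :=
  ∏ h, coinWeight (x h) (s h)

theorem coinWeight_bounds {x : ℝ} (hx : x ∈ Set.Icc (0 : ℝ) 1) (b : Bool) :
    1 / 4 ≤ coinWeight x b := by
  obtain ⟨h0, h1⟩ := hx
  cases b <;> simp only [coinWeight] <;> norm_num <;> linarith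

theorem sum_coinWeight (x : ℝ) : ∑ b, coinWeight x b = 1 := by
  simp [coinWeight]; ring

theorem sum_signWeight {H : ℕ} (x : Fin H → ℝ) : ∑ s, signWeight x s = 1 := by
  have := Finset.prod_univ_sum (fun _ : Fin H => (Finset.univ : Finset Bool))
    (fun h b => coinWeight (x h) b)
  simp only [sum_coinWeight, Finset.prod_const_one, Fintype.piFinset_univ] at this
  exact this.symm

theorem signWeight_nonneg {H : ℕ} {x : Fin H → ℝ} (hx : ∀ h, x h ∈ Set.Icc (0 : ℝ) 1)
    (s : Fin H → Bool) : 0 ≤ signWeight x s :=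
  Finset.prod_nonneg fun h _ => by linarith [coinWeight_bounds (hx h) (s h)]

theorem sq_sqrt_sub_sqrt_le {u v : ℝ} (hu : 1 / 4 ≤ u) (hv : 1 / 4 ≤ v) :
    (√u - √v) ^ 2 ≤ (u - v) ^ 2 := by
  have h1 : 1 / 2 ≤ √u := Real.le_sqrt_of_sq_le (by norm_num; linarith)
  have h2 : 1 / 2 ≤ √v := Real.le_sqrt_of_sq_le (by norm_num; linarith)
  have e : u - v = (√u - √v) * (√u + √v) := by
    nlinarith [Real.sq_sqrt (show 0 ≤ u by linarith), Real.sq_sqrt (show 0 ≤ v by linarith)]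
  rw [e, mul_pow]
  refine le_mul_of_one_le_right (sq_nonneg _) ?_
  nlinarith

theorem one_sub_sum_le_prod_one_sub {ι : Type*} (s : Finset ι) (a : ι → ℝ)
    (h0 : ∀ i, 0 ≤ a i) (h1 : ∀ i, a i ≤ 1) : 1 - ∑ i ∈ s, a i ≤ ∏ i ∈ s, (1 - a i) := by
  classical
  induction s using Finset.induction_on with
  | empty => simp
  | insert i s hi ih =>
    rw [Finset.sum_insert hi, Finset.prod_insert hi]
    have hp : 0 ≤ ∑ i ∈ s, a i := Finset.sum_nonneg fun i _ => h0 i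
    nlinarith [mul_le_mul_of_nonneg_left ih (sub_nonneg.2 (h1 i)), mul_nonneg (h0 i) hp]

/-- Subadditivity of the squared Hellinger distance for product laws, applied to the laws of two
reward vectors. -/
theorem sum_sq_sqrt_signWeight_sub_le {H : ℕ} {x y : Fin H → ℝ}
    (hx : ∀ h, x h ∈ Set.Icc (0 : ℝ) 1) (hy : ∀ h, y h ∈ Set.Icc (0 : ℝ) 1) :
    ∑ s, (√(signWeight x s) - √(signWeight y s)) ^ 2 ≤ ∑ h, (x h - y h) ^ 2 := by
  have expand : ∀ {ι : Type} [Fintype ι] (u v : ι → ℝ), (∀ i, 0 ≤ u i) → (∀ i, 0 ≤ v i) →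
      ∑ i, u i = 1 → ∑ i, v i = 1 →
      ∑ i, (√(u i) - √(v i)) ^ 2 = 2 - 2 * ∑ i, √(u i) * √(v i) := by
    intro ι _ u v hu hv hu1 hv1
    have : ∀ i, (√(u i) - √(v i)) ^ 2 = u i + v i - 2 * (√(u i) * √(v i)) := fun i => by
      nlinarith [Real.sq_sqrt (hu i), Real.sq_sqrt (hv i)]
    simp only [this, Finset.sum_sub_distrib, Finset.sum_add_distrib, hu1, hv1, Finset.mul_sum]
    norm_num
  have hcx : ∀ h b, 0 ≤ coinWeight (x h) b := fun h b => by
    linarith [coinWeight_bounds (hx h) b]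
  have hcy : ∀ h b, 0 ≤ coinWeight (y h) b := fun h b => by
    linarith [coinWeight_bounds (hy h) b]
  let ρ : Fin H → ℝ := fun h => ∑ b, √(coinWeight (x h) b) * √(coinWeight (y h) b)
  have hone : ∀ h, ∑ b, (√(coinWeight (x h) b) - √(coinWeight (y h) b)) ^ 2 = 2 - 2 * ρ h :=
    fun h => expand _ _ (hcx h) (hcy h) (sum_coinWeight _) (sum_coinWeight _)
  have hle : ∀ h, 2 - 2 * ρ h ≤ (x h - y h) ^ 2 := fun h => by
    rw [← hone h]
    have h1 := sq_sqrt_sub_sqrt_le (coinWeight_bounds (hx h) true) (coinWeight_bounds (hy h) true)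
    have h2 := sq_sqrt_sub_sqrt_le (coinWeight_bounds (hx h) false)
      (coinWeight_bounds (hy h) false)
    simp only [Fintype.sum_bool]
    simp only [coinWeight, if_true, Bool.false_eq_true, if_false] at h1 h2 ⊢
    nlinarith [sq_nonneg (x h - y h)]
  have hρ1 : ∀ h, 0 ≤ 1 - ρ h := fun h => by
    have : 0 ≤ 2 - 2 * ρ h := hone h ▸ Finset.sum_nonneg fun b _ => sq_nonneg _
    linarith
  have hρ0 : ∀ h, 0 ≤ ρ h := fun h =>
    Finset.sum_nonneg fun b _ => mul_nonneg (Real.sqrt_nonneg _) (Real.sqrt_nonneg _)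
  have hprod : ∑ s, √(signWeight x s) * √(signWeight y s) = ∏ h, ρ h := by
    have := Finset.prod_univ_sum (fun _ : Fin H => (Finset.univ : Finset Bool))
      (fun h b => √(coinWeight (x h) b) * √(coinWeight (y h) b))
    rw [Fintype.piFinset_univ] at this
    refine Eq.trans (Finset.sum_congr rfl fun s _ => ?_) this.symm
    rw [signWeight, signWeight, Real.sqrt_eq_rpow, Real.sqrt_eq_rpow,
      ← Real.finsetProd_rpow _ _ (fun h _ => hcx h _),
      ← Real.finsetProd_rpow _ _ (fun h _ => hcy h _), ← Finset.prod_mul_distrib]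
    simp only [← Real.sqrt_eq_rpow]
  rw [expand _ _ (signWeight_nonneg hx) (signWeight_nonneg hy) (sum_signWeight x)
    (sum_signWeight y), hprod]
  have h1 := one_sub_sum_le_prod_one_sub Finset.univ (fun h => 1 - ρ h) hρ1
    (fun h => by linarith [hρ0 h])
  simp only [sub_sub_cancel] at h1
  have h2 : ∑ h, (2 - 2 * ρ h) ≤ ∑ h, (x h - y h) ^ 2 := Finset.sum_le_sum fun h _ => hle h
  have h3 : ∑ h, (2 - 2 * ρ h) = 2 * ∑ h, (1 - ρ h) := by
    rw [Finset.mul_sum]; exact Finset.sum_congr rfl fun h _ => by ring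
  linarith

instance (x : ℝ) : IsFiniteMeasure (coinMeasure x) := by
  unfold coinMeasure
  refine ⟨?_⟩
  simp

theorem isProbabilityMeasure_coinMeasure {x : ℝ} (hx : x ∈ Set.Icc (0 : ℝ) 1) :
    IsProbabilityMeasure (coinMeasure x) := by
  refine ⟨?_⟩
  have h : ∀ b, 0 ≤ coinWeight x b := fun b => by linarith [coinWeight_bounds hx b]
  simp only [coinMeasure, Measure.finsetSum_apply, Measure.smul_apply, measure_univ, smul_eq_mul,
    mul_one]
  rw [← ENNReal.ofReal_sum_of_nonneg fun b _ => h b, sum_coinWeight, ENNReal.ofReal_one]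

theorem integral_id_coinMeasure {x : ℝ} (hx : x ∈ Set.Icc (0 : ℝ) 1) :
    ∫ r, r ∂(coinMeasure x) = x := by
  have h : ∀ b, 0 ≤ coinWeight x b := fun b => by linarith [coinWeight_bounds hx b]
  rw [coinMeasure, integral_finsetSum_measure
    fun b _ => (integrable_dirac (by simp)).smul_measure ENNReal.ofReal_ne_top]
  simp only [integral_smul_measure, integral_dirac, ENNReal.toReal_ofReal (h _), Fintype.sum_bool]
  simp [coinWeight, coinValue]; ring

theorem integrable_coinMeasure (x : ℝ) (f : ℝ → ℝ) : Integrable f (coinMeasure x) := by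
  rw [coinMeasure, integrable_finsetSum_measure]
  exact fun b _ => (integrable_dirac (by simp)).smul_measure ENNReal.ofReal_ne_top

theorem pi_coinMeasure {H : ℕ} {x : Fin H → ℝ} (hx : ∀ h, x h ∈ Set.Icc (0 : ℝ) 1) :
    Measure.pi (fun h => coinMeasure (x h)) =
      ∑ s : Fin H → Bool, ENNReal.ofReal (signWeight x s) •
        Measure.dirac (fun h => coinValue (s h)) := by
  have hcx : ∀ h b, 0 ≤ coinWeight (x h) b := fun h b => by
    linarith [coinWeight_bounds (hx h) b]
  refine Measure.pi_eq fun A hA => ?_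
  have := Finset.prod_univ_sum (fun _ : Fin H => (Finset.univ : Finset Bool))
    (fun h b => ENNReal.ofReal (coinWeight (x h) b) * Measure.dirac (coinValue b) (A h))
  rw [Fintype.piFinset_univ] at this
  simp only [coinMeasure, Measure.finsetSum_apply, Measure.smul_apply, smul_eq_mul, this]
  refine Finset.sum_congr rfl fun s _ => ?_
  rw [Finset.prod_mul_distrib, signWeight, ENNReal.ofReal_prod_of_nonneg fun h _ => hcx h _]
  congr 1
  rw [Measure.dirac_apply' _ (MeasurableSet.univ_pi hA)]
  simp only [Measure.dirac_apply' _ (hA _)]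
  by_cases hs : ∀ h, coinValue (s h) ∈ A h
  · have hmem : (fun h => coinValue (s h)) ∈ Set.univ.pi A := fun h _ => hs h
    rw [Set.indicator_of_mem hmem,
      Finset.prod_congr rfl fun h _ => Set.indicator_of_mem (hs h) 1]
    simp
  · obtain ⟨h, hh⟩ := not_forall.1 hs
    have hmem : (fun h => coinValue (s h)) ∉ Set.univ.pi A := fun hm => hh (hm h (Set.mem_univ h))
    rw [Set.indicator_of_notMem hmem,
      Finset.prod_eq_zero (Finset.mem_univ h) (Set.indicator_of_notMem hh 1)]

theorem integral_pi_coinMeasure {H : ℕ} {x : Fin H → ℝ} (hx : ∀ h, x h ∈ Set.Icc (0 : ℝ) 1)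
    {f : (Fin H → ℝ) → ℝ} :
    ∫ r, f r ∂(Measure.pi fun h => coinMeasure (x h)) =
      ∑ s, signWeight x s * f fun h => coinValue (s h) := by
  rw [pi_coinMeasure hx, integral_finsetSum_measure
    fun b _ => (integrable_dirac (by simp)).smul_measure ENNReal.ofReal_ne_top]
  simp only [integral_smul_measure, integral_dirac,
    ENNReal.toReal_ofReal (signWeight_nonneg hx _), smul_eq_mul]

theorem measurable_signWeight {H : ℕ} (s : Fin H → Bool) :
    Measurable fun x : Fin H → ℝ => signWeight x s := by
  unfold signWeight coinWeight
  refine Finset.measurable_prod _ fun h _ => ?_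
  cases s h <;> simp <;> fun_prop

namespace DMSOModel

variable {Pol Obs : Type*} [MeasurableSpace Pol] [MeasurableSpace Obs] {H : ℕ}

/-- The reward distribution with independent entries supported on `{-2, 2}`. The values `±2` keep
both probabilities above `1/4`, so that the Hellinger distance of two such laws is at most the
distance of their means. -/
noncomputable def coinReward (M : DMSOModel Pol Obs H) : M.RewardLaw where
  kernel :=
    { toFun := fun o => Measure.pi fun h => coinMeasure (M.meanReward o h)
      measurable' := by
        refine Measure.measurable_of_measurable_coe _ fun A hA => ?_
        simp only [pi_coinMeasure (M.meanReward_mem _), Measure.finsetSum_apply,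
          Measure.smul_apply, smul_eq_mul]
        exact Finset.measurable_sum _ fun s _ =>
          (((measurable_signWeight s).comp M.measurable_meanReward).ennreal_ofReal).mul_const _ }
  markov := ⟨fun o => by
    have := fun h => isProbabilityMeasure_coinMeasure (M.meanReward_mem o h)
    exact inferInstanceAs (IsProbabilityMeasure (Measure.pi _))⟩
  indep := fun o => by
    have := fun h => isProbabilityMeasure_coinMeasure (M.meanReward_mem o h)
    exact iIndepFun_pi (X := fun _ r => r) fun h => aemeasurable_id
  integrable := fun o h => by
    have := fun h => isProbabilityMeasure_coinMeasure (M.meanReward_mem o h)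
    exact integrable_comp_eval (i := h) (f := fun r => r)
      (integrable_coinMeasure (M.meanReward o h) fun r => r)
  mean := fun o h => by
    have := fun h => isProbabilityMeasure_coinMeasure (M.meanReward_mem o h)
    refine Eq.trans (integral_comp_eval (μ := fun h => coinMeasure (M.meanReward o h)) (i := h)
      (f := fun r => r) measurable_id.aestronglyMeasurable)
      (integral_id_coinMeasure (M.meanReward_mem o h))

theorem integral_coinReward (M : DMSOModel Pol Obs H) (o : Obs) (f : (Fin H → ℝ) → ℝ) :
    ∫ r, f r ∂(M.coinReward.kernel o) =
      ∑ s, signWeight (M.meanReward o) s * f fun h => coinValue (s h) :=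
  integral_pi_coinMeasure (M.meanReward_mem o)

theorem coinReward_mem (M : DMSOModel Pol Obs H) (o : Obs) :
    ∀ᵐ r ∂(M.coinReward.kernel o), ∀ h, r h ∈ Set.Icc (-2 : ℝ) 2 := by
  have hker : M.coinReward.kernel o = Measure.pi fun h => coinMeasure (M.meanReward o h) := rfl
  rw [hker, pi_coinMeasure (M.meanReward_mem o)]
  refine (ae_finsetSum_measure_iff).2 fun s _ => ?_
  refine Measure.ae_smul_measure ?_ _
  rw [ae_dirac_eq]
  intro h
  change coinValue (s h) ∈ _
  generalize s h = b
  cases b <;> simp [coinValue]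

end DMSOModel

/-! ### Bounds and measurability of the divergence and of the values -/

theorem integrable_of_bounds {X : Type*} [MeasurableSpace X] {μ : Measure X} [IsFiniteMeasure μ]
    {f : X → ℝ} {a b : ℝ} (hf : Measurable f) (h : ∀ x, f x ∈ Set.Icc a b) : Integrable f μ :=
  Integrable.of_mem_Icc a b hf.aemeasurable (.of_forall h)

theorem integral_mem_Icc {X : Type*} [MeasurableSpace X] {μ : Measure X} [IsProbabilityMeasure μ]
    {f : X → ℝ} {a b : ℝ} (hf : Measurable f) (h : ∀ x, f x ∈ Set.Icc a b) :
    ∫ x, f x ∂μ ∈ Set.Icc a b := by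
  have hi : Integrable f μ := integrable_of_bounds hf h
  constructor
  · simpa using integral_mono (integrable_const a) hi fun x => (h x).1
  · simpa using integral_mono hi (integrable_const b) fun x => (h x).2

theorem sq_sqrt_sub_sqrt_le_add {u v : ℝ} (hu : 0 ≤ u) (hv : 0 ≤ v) :
    (√u - √v) ^ 2 ≤ u + v := by
  nlinarith [Real.sq_sqrt hu, Real.sq_sqrt hv, mul_nonneg (Real.sqrt_nonneg u) (Real.sqrt_nonneg v)]

theorem integrable_hellinger {X : Type*} [MeasurableSpace X] (P Q : Measure X) [IsFiniteMeasure P]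
    [IsFiniteMeasure Q] :
    Integrable (fun x => (√(P.rnDeriv (P + Q) x).toReal - √(Q.rnDeriv (P + Q) x).toReal) ^ 2)
      (P + Q) := by
  have hp := (Measure.measurable_rnDeriv P (P + Q)).ennreal_toReal
  have hq := (Measure.measurable_rnDeriv Q (P + Q)).ennreal_toReal
  refine ((Measure.integrable_toReal_rnDeriv (μ := P) (ν := P + Q)).add
    (Measure.integrable_toReal_rnDeriv (μ := Q) (ν := P + Q))).mono'
    ((hp.sqrt.sub hq.sqrt).pow_const 2).aestronglyMeasurable (.of_forall fun x => ?_)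
  rw [Real.norm_of_nonneg (sq_nonneg _)]
  exact sq_sqrt_sub_sqrt_le_add ENNReal.toReal_nonneg ENNReal.toReal_nonneg

theorem hellingerSq_mem {X : Type*} [MeasurableSpace X] (P Q : Measure X) [IsProbabilityMeasure P]
    [IsProbabilityMeasure Q] : hellingerSq P Q ∈ Set.Icc (0 : ℝ) 2 := by
  refine ⟨integral_nonneg fun x => sq_nonneg _, ?_⟩
  have hP : P ≪ P + Q := Measure.AbsolutelyContinuous.rfl.add_right Q
  have hQ : Q ≪ P + Q := add_comm Q P ▸ Measure.AbsolutelyContinuous.rfl.add_right P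
  have ip := Measure.integrable_toReal_rnDeriv (μ := P) (ν := P + Q)
  have iq := Measure.integrable_toReal_rnDeriv (μ := Q) (ν := P + Q)
  refine (integral_mono (integrable_hellinger P Q) (ip.add iq) fun x =>
    sq_sqrt_sub_sqrt_le_add ENNReal.toReal_nonneg ENNReal.toReal_nonneg).trans ?_
  rw [integral_add' ip iq, Measure.integral_toReal_rnDeriv hP, Measure.integral_toReal_rnDeriv hQ]
  simp; norm_num

theorem measurable_hellingerSq {α X : Type*} [MeasurableSpace α] [MeasurableSpace X]
    [MeasurableSpace.CountableOrCountablyGenerated α X] (κ η : Kernel α X) [IsFiniteKernel κ]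
    [IsFiniteKernel η] : Measurable fun a => hellingerSq (κ a) (η a) := by
  have h : ∀ a, hellingerSq (κ a) (η a) = ∫ x, (√(Kernel.rnDeriv κ (κ + η) a x).toReal -
      √(Kernel.rnDeriv η (κ + η) a x).toReal) ^ 2 ∂((κ + η) a) := fun a => by
    refine integral_congr_ae ?_
    have h1 := Kernel.rnDeriv_eq_rnDeriv_measure (κ := κ) (η := κ + η) (a := a)
    have h2 := Kernel.rnDeriv_eq_rnDeriv_measure (κ := η) (η := κ + η) (a := a)
    rw [add_apply] at h1 h2
    filter_upwards [h1, h2] with x hx1 hx2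
    rw [hx1, hx2]
  simp only [h]
  refine (StronglyMeasurable.integral_kernel_prod_right' (κ := κ + η)
    (f := fun p => (√(Kernel.rnDeriv κ (κ + η) p.1 p.2).toReal -
      √(Kernel.rnDeriv η (κ + η) p.1 p.2).toReal) ^ 2) ?_).measurable
  exact (((Kernel.measurable_rnDeriv κ (κ + η)).ennreal_toReal.sqrt.sub
    (Kernel.measurable_rnDeriv η (κ + η)).ennreal_toReal.sqrt).pow_const 2).stronglyMeasurable

namespace DMSOModel

variable {Pol Obs : Type*} [MeasurableSpace Pol] [MeasurableSpace Obs] {H : ℕ}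

theorem measurable_meanReward_apply (M : DMSOModel Pol Obs H) (h : Fin H) :
    Measurable fun o => M.meanReward o h :=
  (measurable_pi_apply h).comp M.measurable_meanReward

theorem measurable_sum_sq_sub (M M' : DMSOModel Pol Obs H) :
    Measurable fun o => ∑ h, (M.meanReward o h - M'.meanReward o h) ^ 2 :=
  Finset.measurable_sum _ fun h _ =>
    ((M.measurable_meanReward_apply h).sub (M'.measurable_meanReward_apply h)).pow_const 2

theorem sum_sq_sub_mem (M M' : DMSOModel Pol Obs H) (o : Obs) :
    ∑ h, (M.meanReward o h - M'.meanReward o h) ^ 2 ∈ Set.Icc (0 : ℝ) H := by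
  refine ⟨Finset.sum_nonneg fun h _ => sq_nonneg _, ?_⟩
  have : ∀ h, (M.meanReward o h - M'.meanReward o h) ^ 2 ≤ 1 := fun h => by
    have h1 := M.meanReward_mem o h
    have h2 := M'.meanReward_mem o h
    rw [sq_le_one_iff_abs_le_one, abs_le]
    constructor <;> linarith [h1.1, h1.2, h2.1, h2.2]
  simpa using Finset.sum_le_sum fun h (_ : h ∈ Finset.univ) => this h

theorem dRLSq_mem (M M' : DMSOModel Pol Obs H) (π : Pol) :
    dRLSq M M' π ∈ Set.Icc (0 : ℝ) (2 + H) := by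
  have h1 := hellingerSq_mem (M.obs π) (M'.obs π)
  have h2 := integral_mem_Icc (μ := M.obs π) (measurable_sum_sq_sub M M') (sum_sq_sub_mem M M')
  exact ⟨add_nonneg h1.1 h2.1, add_le_add h1.2 h2.2⟩

theorem measurable_dRLSq [MeasurableSpace.CountableOrCountablyGenerated Pol Obs]
    (M M' : DMSOModel Pol Obs H) : Measurable (dRLSq M M') :=
  (measurable_hellingerSq M.obs M'.obs).add
    (measurable_sum_sq_sub M M').stronglyMeasurable.integral_kernel.measurable

theorem measurable_value (M : DMSOModel Pol Obs H) : Measurable M.value :=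
  (Finset.measurable_sum _ fun h _ =>
    M.measurable_meanReward_apply h).stronglyMeasurable.integral_kernel.measurable

theorem value_mem (M : DMSOModel Pol Obs H) (π : Pol) : M.value π ∈ Set.Icc (0 : ℝ) H := by
  refine integral_mem_Icc (Finset.measurable_sum _ fun h _ => M.measurable_meanReward_apply h)
    fun o => ⟨Finset.sum_nonneg fun h _ => (M.meanReward_mem o h).1, ?_⟩
  simpa using Finset.sum_le_sum fun h (_ : h ∈ Finset.univ) => (M.meanReward_mem o h).2

theorem gap_mem (M : DMSOModel Pol Obs H) (π : Pol) : M.gap π ∈ Set.Icc (0 : ℝ) H := by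
  have : Nonempty Pol := ⟨π⟩
  have hb : BddAbove (Set.range M.value) := ⟨H, by rintro _ ⟨π, rfl⟩; exact (M.value_mem π).2⟩
  have h1 : M.value π ≤ M.optValue := le_ciSup hb π
  have h2 : M.optValue ≤ H := ciSup_le fun π => (M.value_mem π).2
  have h3 := M.value_mem π
  unfold gap
  constructor <;> linarith [h3.1]

theorem measurable_gap (M : DMSOModel Pol Obs H) : Measurable M.gap :=
  measurable_const.sub M.measurable_value

theorem subOpt_eq_integral_gap (M : DMSOModel Pol Obs H) (p : Measure Pol)
    [IsProbabilityMeasure p] : PACAlgorithm.subOpt M p = ∫ π, M.gap π ∂p := by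
  simp only [PACAlgorithm.subOpt, gap]
  rw [integral_sub (integrable_const _) (integrable_of_bounds M.measurable_value M.value_mem)]
  simp

/-! ### One episode -/

theorem integral_outcome_coinReward (M : DMSOModel Pol Obs H) (π : Pol)
    {F : Obs × (Fin H → ℝ) → ℝ} (hF : Measurable F) (hF1 : ∀ z, F z ∈ Set.Icc (0 : ℝ) 1) :
    ∫ z, F z ∂(M.outcome M.coinReward π) =
      ∫ o, ∑ s, signWeight (M.meanReward o) s * F (o, fun h => coinValue (s h)) ∂(M.obs π) := by
  rw [outcome, ProbabilityTheory.integral_compProd (integrable_of_bounds hF hF1)]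
  refine integral_congr_ae (.of_forall fun o => ?_)
  exact integral_coinReward M o fun r => F (o, r)

theorem measurable_sum_signWeight_mul (M : DMSOModel Pol Obs H)
    {F : Obs × (Fin H → ℝ) → ℝ} (hF : Measurable F) :
    Measurable fun o =>
      ∑ s, signWeight (M.meanReward o) s * F (o, fun h => coinValue (s h)) :=
  Finset.measurable_sum _ fun s _ =>
    ((measurable_signWeight s).comp M.measurable_meanReward).mul (by fun_prop)

theorem sum_signWeight_mul_mem (M : DMSOModel Pol Obs H)
    {F : Obs × (Fin H → ℝ) → ℝ} (hF1 : ∀ z, F z ∈ Set.Icc (0 : ℝ) 1) (o : Obs) :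
    ∑ s, signWeight (M.meanReward o) s * F (o, fun h => coinValue (s h)) ∈ Set.Icc (0 : ℝ) 1 := by
  have hw := signWeight_nonneg (M.meanReward_mem o)
  refine ⟨Finset.sum_nonneg fun s _ => mul_nonneg (hw s) (hF1 _).1, ?_⟩
  rw [← sum_signWeight (M.meanReward o)]
  exact Finset.sum_le_sum fun s _ => mul_le_of_le_one_right (hw s) (hF1 _).2

/-- The densities `p q` of two observation laws at a point, together with the laws `x y` of the
signs: the pointwise form of `sub_dRLSq_le_outcome_mixture`. -/
theorem sub_sq_le_sum_signWeight {l p q : ℝ} (hl : 0 ≤ l) (hp : 0 ≤ p) (hq : 0 ≤ q)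
    {x y : Fin H → ℝ} (hx : ∀ h, x h ∈ Set.Icc (0 : ℝ) 1) (hy : ∀ h, y h ∈ Set.Icc (0 : ℝ) 1)
    (G : (Fin H → Bool) → ℝ) :
    (l ^ 2 * q + l * p) / (1 + l) ^ 2 - 4 * (√p - √q) ^ 2 - 4 * (p * ∑ h, (x h - y h) ^ 2) ≤
      q * ∑ s, signWeight y s * (1 - G s) ^ 2 + l * (p * ∑ s, signWeight x s * G s ^ 2) := by
  have hs : ∀ s, (l ^ 2 * q * signWeight y s + l * p * signWeight x s) / (1 + l) ^ 2
        - (4 * (√p - √q) ^ 2 * signWeight y s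
            + 4 * p * (√(signWeight x s) - √(signWeight y s)) ^ 2) ≤
      q * (signWeight y s * (1 - G s) ^ 2) + l * p * (signWeight x s * G s ^ 2) := fun s => by
    have hwx := signWeight_nonneg hx s
    have hwy := signWeight_nonneg hy s
    have h := tangent_sub_sq_le_mixture (a := √q * √(signWeight y s))
      (b := √p * √(signWeight x s)) hl (G s)
    simp only [mul_pow, Real.sq_sqrt hp, Real.sq_sqrt hq, Real.sq_sqrt hwx,
      Real.sq_sqrt hwy] at h
    have split : (√q * √(signWeight y s) - √p * √(signWeight x s)) ^ 2 ≤
        2 * ((√p - √q) ^ 2 * signWeight y s)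
          + 2 * (p * (√(signWeight x s) - √(signWeight y s)) ^ 2) := by
      have e1 : (√p - √q) ^ 2 * signWeight y s = ((√p - √q) * √(signWeight y s)) ^ 2 := by
        rw [mul_pow, Real.sq_sqrt hwy]
      have e2 : p * (√(signWeight x s) - √(signWeight y s)) ^ 2 =
          (√p * (√(signWeight x s) - √(signWeight y s))) ^ 2 := by
        rw [mul_pow, Real.sq_sqrt hp]
      rw [e1, e2]
      nlinarith [sq_nonneg ((√p - √q) * √(signWeight y s)
        - √p * (√(signWeight x s) - √(signWeight y s)))]
    have e3 : (l ^ 2 * q * signWeight y s + l * p * signWeight x s) / (1 + l) ^ 2 =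
      (l ^ 2 * (q * signWeight y s) + l * (p * signWeight x s)) / (1 + l) ^ 2 := by ring
    rw [e3]
    linarith
  have hsum := Finset.sum_le_sum fun s (_ : s ∈ Finset.univ) => hs s
  simp only [Finset.sum_sub_distrib, Finset.sum_add_distrib, ← Finset.sum_div, ← Finset.mul_sum,
    sum_signWeight, mul_one] at hsum
  have htens := mul_le_mul_of_nonneg_left (sum_sq_sqrt_signWeight_sub_le hx hy) hp
  linarith

/-- Discriminating one episode of `M` from one episode of `M'` under the same policy: no test does
better than `l / (1 + l)`, the value for equal laws, by more than a multiple of the divergence. -/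
theorem sub_dRLSq_le_outcome_mixture (M M' : DMSOModel Pol Obs H) (π : Pol) {l : ℝ} (hl : 0 ≤ l)
    {G : Obs × (Fin H → ℝ) → ℝ} (hG : Measurable G) (hG1 : ∀ z, G z ∈ Set.Icc (0 : ℝ) 1) :
    l / (1 + l) - 4 * dRLSq M M' π ≤
      ∫ z, (1 - G z) ^ 2 ∂(M'.outcome M'.coinReward π)
        + l * ∫ z, G z ^ 2 ∂(M.outcome M.coinReward π) := by
  have hm0 : Measurable fun z => (1 - G z) ^ 2 := (measurable_const.sub hG).pow_const 2
  have hm1 : Measurable fun z => G z ^ 2 := hG.pow_const 2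
  have hb0 : ∀ z, (1 - G z) ^ 2 ∈ Set.Icc (0 : ℝ) 1 := fun z =>
    ⟨sq_nonneg _, by nlinarith [(hG1 z).1, (hG1 z).2]⟩
  have hb1 : ∀ z, G z ^ 2 ∈ Set.Icc (0 : ℝ) 1 := fun z =>
    ⟨sq_nonneg _, by nlinarith [(hG1 z).1, (hG1 z).2]⟩
  rw [integral_outcome_coinReward M' π hm0 hb0, integral_outcome_coinReward M π hm1 hb1]
  set P := M.obs π
  set Q := M'.obs π
  have hP : P ≪ P + Q := Measure.AbsolutelyContinuous.rfl.add_right Q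
  have hQ : Q ≪ P + Q := add_comm Q P ▸ Measure.AbsolutelyContinuous.rfl.add_right P
  have ip := Measure.integrable_toReal_rnDeriv (μ := P) (ν := P + Q)
  have iq := Measure.integrable_toReal_rnDeriv (μ := Q) (ν := P + Q)
  have ih := integrable_hellinger P Q
  have ir := (integrable_toReal_rnDeriv_mul_iff hP).2 (integrable_of_bounds (μ := P)
    (measurable_sum_sq_sub M M') (sum_sq_sub_mem M M'))
  have i0 := (integrable_toReal_rnDeriv_mul_iff hQ).2 (integrable_of_bounds (μ := Q)
    (M'.measurable_sum_signWeight_mul hm0) (M'.sum_signWeight_mul_mem hb0))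
  have i1 := (integrable_toReal_rnDeriv_mul_iff hP).2 (integrable_of_bounds (μ := P)
    (M.measurable_sum_signWeight_mul hm1) (M.sum_signWeight_mul_mem hb1))
  have j1 : Integrable (fun o => (l ^ 2 * (Q.rnDeriv (P + Q) o).toReal
      + l * (P.rnDeriv (P + Q) o).toReal) / (1 + l) ^ 2) (P + Q) :=
    ((iq.const_mul _).add (ip.const_mul _)).div_const _
  have j2 : Integrable (fun o => (l ^ 2 * (Q.rnDeriv (P + Q) o).toReal
      + l * (P.rnDeriv (P + Q) o).toReal) / (1 + l) ^ 2
        - 4 * (√(P.rnDeriv (P + Q) o).toReal - √(Q.rnDeriv (P + Q) o).toReal) ^ 2) (P + Q) :=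
    j1.sub (ih.const_mul _)
  have hlow : l / (1 + l) - 4 * dRLSq M M' π =
      ∫ o, ((l ^ 2 * (Q.rnDeriv (P + Q) o).toReal + l * (P.rnDeriv (P + Q) o).toReal) / (1 + l) ^ 2
        - 4 * (√(P.rnDeriv (P + Q) o).toReal - √(Q.rnDeriv (P + Q) o).toReal) ^ 2
        - 4 * ((P.rnDeriv (P + Q) o).toReal *
          ∑ h, (M.meanReward o h - M'.meanReward o h) ^ 2)) ∂(P + Q) := by
    rw [integral_sub j2 (ir.const_mul _), integral_sub j1 (ih.const_mul _), integral_div,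
      integral_add (iq.const_mul _) (ip.const_mul _)]
    simp only [integral_const_mul]
    rw [Measure.integral_toReal_rnDeriv hP, Measure.integral_toReal_rnDeriv hQ,
      integral_toReal_rnDeriv_mul hP]
    simp only [probReal_univ, dRLSq, hellingerSq]
    have : 1 + l ≠ 0 := by positivity
    have e : l / (1 + l) = (l ^ 2 * 1 + l * 1) / (1 + l) ^ 2 := by field_simp; ring
    rw [e]; ring
  rw [hlow, ← integral_toReal_rnDeriv_mul hP, ← integral_toReal_rnDeriv_mul hQ,
    ← integral_const_mul, ← integral_add i0 (i1.const_mul _)]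
  refine integral_mono (j2.sub (ir.const_mul _)) (i0.add (i1.const_mul _)) fun o => ?_
  exact sub_sq_le_sum_signWeight hl ENNReal.toReal_nonneg ENNReal.toReal_nonneg
    (M.meanReward_mem o) (M'.meanReward_mem o) _

end DMSOModel

/-! ### The whole interaction -/

theorem measurable_snoc {E : Type*} [MeasurableSpace E] (t : ℕ) :
    Measurable fun p : (Fin t → E) × E => Fin.snoc (α := fun _ => E) p.1 p.2 := by
  refine measurable_pi_iff.2 fun i => ?_
  induction i using Fin.lastCases with
  | last => simpa using measurable_snd
  | cast i => simpa using! (measurable_pi_apply i).comp measurable_fst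

namespace PACAlgorithm

open DMSOModel

variable {Pol Obs : Type*} [MeasurableSpace Pol] [MeasurableSpace Obs] {H T : ℕ}

instance isProbabilityMeasure_historyLaw (A : PACAlgorithm Pol Obs H T)
    (M : DMSOModel Pol Obs H) (R : M.RewardLaw) (t : ℕ) (ht : t ≤ T) :
    IsProbabilityMeasure (A.historyLaw M R t ht) := by
  induction t with
  | zero => unfold historyLaw; infer_instance
  | succ t ih =>
    have := ih (Nat.le_of_succ_le ht)
    unfold historyLaw
    exact Measure.isProbabilityMeasure_map (measurable_snoc t).aemeasurable

/-- The law of the policy executed in the episode that is preceded by `t` episodes. -/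
noncomputable def policyLaw (A : PACAlgorithm Pol Obs H T) (M : DMSOModel Pol Obs H)
    (R : M.RewardLaw) (t : ℕ) (ht : t < T) : Measure Pol :=
  A.explore t ht ∘ₘ A.historyLaw M R t ht.le

instance (A : PACAlgorithm Pol Obs H T) (M : DMSOModel Pol Obs H) (R : M.RewardLaw) (t : ℕ)
    (ht : t < T) : IsProbabilityMeasure (A.policyLaw M R t ht) := by
  unfold policyLaw; infer_instance

theorem integral_measureComp {α β : Type*} [MeasurableSpace α] [MeasurableSpace β]
    {μ : Measure α} [IsProbabilityMeasure μ] {κ : Kernel α β} [IsMarkovKernel κ] {f : β → ℝ}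
    {a b : ℝ} (hf : Measurable f) (h : ∀ x, f x ∈ Set.Icc a b) :
    ∫ y, f y ∂(κ ∘ₘ μ) = ∫ x, ∫ y, f y ∂(κ x) ∂μ := by
  have : Integrable f (κ ∘ₘ μ) := integrable_of_bounds hf h
  rw [Measure.comp_eq_comp_const_apply] at this ⊢
  rw [Kernel.integral_comp this, Kernel.const_apply]

theorem integral_historyLaw_succ (A : PACAlgorithm Pol Obs H T) (M : DMSOModel Pol Obs H)
    (R : M.RewardLaw) (t : ℕ) (ht : t + 1 ≤ T) {f : (Fin (t + 1) → Episode Pol Obs H) → ℝ}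
    (hf : Measurable f) (hf1 : ∀ x, f x ∈ Set.Icc (0 : ℝ) 1) :
    ∫ x, f x ∂(A.historyLaw M R (t + 1) ht) =
      ∫ x, ∫ e, f (Fin.snoc (α := fun _ => Episode Pol Obs H) x e) ∂(A.step M R t ht x)
        ∂(A.historyLaw M R t (Nat.le_of_succ_le ht)) := by
  rw [historyLaw, integral_map (measurable_snoc t).aemeasurable hf.aestronglyMeasurable,
    Measure.integral_compProd]
  exact integrable_of_bounds (hf.comp (measurable_snoc t)) fun _ => hf1 _

/-- The bound for one episode, for the policy drawn by the algorithm. -/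
theorem sub_integral_dRLSq_le_step_mixture [MeasurableSpace.CountableOrCountablyGenerated Pol Obs]
    (A : PACAlgorithm Pol Obs H T) (M M' : DMSOModel Pol Obs H) (t : ℕ) (ht : t < T)
    (x : Fin t → Episode Pol Obs H) {l : ℝ} (hl : 0 ≤ l) {g : Episode Pol Obs H → ℝ}
    (hg : Measurable g) (hg1 : ∀ e, g e ∈ Set.Icc (0 : ℝ) 1) :
    l / (1 + l) - 4 * ∫ π, dRLSq M M' π ∂(A.explore t ht x) ≤
      ∫ e, (1 - g e) ^ 2 ∂(A.step M' M'.coinReward t ht x)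
        + l * ∫ e, g e ^ 2 ∂(A.step M M.coinReward t ht x) := by
  have hm0 : Measurable fun e => (1 - g e) ^ 2 := (measurable_const.sub hg).pow_const 2
  have hm1 : Measurable fun e => g e ^ 2 := hg.pow_const 2
  have hb0 : ∀ e, (1 - g e) ^ 2 ∈ Set.Icc (0 : ℝ) 1 := fun e =>
    ⟨sq_nonneg _, by nlinarith [(hg1 e).1, (hg1 e).2]⟩
  have hb1 : ∀ e, g e ^ 2 ∈ Set.Icc (0 : ℝ) 1 := fun e =>
    ⟨sq_nonneg _, by nlinarith [(hg1 e).1, (hg1 e).2]⟩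
  have hstep : ∀ (N : DMSOModel Pol Obs H) (f : Episode Pol Obs H → ℝ), Measurable f →
      (∀ e, f e ∈ Set.Icc (0 : ℝ) 1) →
      Integrable (fun π => ∫ z, f (π, z) ∂(N.outcome N.coinReward π)) (A.explore t ht x) ∧
      ∫ e, f e ∂(A.step N N.coinReward t ht x) =
        ∫ π, ∫ z, f (π, z) ∂(N.outcome N.coinReward π) ∂(A.explore t ht x) := by
    intro N f hf hf1
    refine ⟨integrable_of_bounds (a := 0) (b := 1) ?_ fun π =>
      integral_mem_Icc (hf.comp measurable_prodMk_left) fun z => hf1 _, ?_⟩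
    · exact hf.stronglyMeasurable.integral_kernel_prod_right'.measurable
    · rw [step, ProbabilityTheory.integral_compProd (integrable_of_bounds hf hf1)]
      simp only [Kernel.prodMkLeft_apply]
  obtain ⟨i0, e0⟩ := hstep M' _ hm0 hb0
  obtain ⟨i1, e1⟩ := hstep M _ hm1 hb1
  have ir : Integrable (dRLSq M M') (A.explore t ht x) :=
    integrable_of_bounds (measurable_dRLSq M M') (dRLSq_mem M M')
  have hc : l / (1 + l) - 4 * ∫ π, dRLSq M M' π ∂(A.explore t ht x) =
      ∫ π, (l / (1 + l) - 4 * dRLSq M M' π) ∂(A.explore t ht x) := by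
    rw [integral_sub (integrable_const _) (ir.const_mul _), integral_const_mul]
    simp
  rw [e0, e1, hc, ← integral_const_mul, ← integral_add i0 (i1.const_mul _)]
  exact integral_mono ((integrable_const _).sub (ir.const_mul _)) (i0.add (i1.const_mul _))
    fun π => sub_dRLSq_le_outcome_mixture M M' π hl (hg.comp measurable_prodMk_left)
      fun z => hg1 _

/-- Subadditivity over the episodes: discriminating the interactions with `M` and with `M'` is
controlled by the sum of the divergences at the policies executed under `M'`. A test of `t + 1`
episodes is reduced to the test of `t` episodes given by its conditional `L²` norm under `M`; the
multiplier of the one-episode bound is optimized separately for each history. -/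
theorem sub_sum_dRLSq_le_historyLaw_mixture
    [MeasurableSpace.CountableOrCountablyGenerated Pol Obs] (A : PACAlgorithm Pol Obs H T)
    (M M' : DMSOModel Pol Obs H) {l : ℝ} (hl : 0 ≤ l) (t : ℕ) (ht : t ≤ T)
    {f : (Fin t → Episode Pol Obs H) → ℝ} (hf : Measurable f)
    (hf1 : ∀ x, f x ∈ Set.Icc (0 : ℝ) 1) :
    l / (1 + l) - 4 * ∑ s : Fin t,
        ∫ π, dRLSq M M' π ∂(A.policyLaw M' M'.coinReward s (s.2.trans_le ht)) ≤
      ∫ x, (1 - f x) ^ 2 ∂(A.historyLaw M' M'.coinReward t ht)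
        + l * ∫ x, f x ^ 2 ∂(A.historyLaw M M.coinReward t ht) := by
  induction t with
  | zero =>
    have hm0 : Measurable fun x => (1 - f x) ^ 2 := (measurable_const.sub hf).pow_const 2
    have hm1 : Measurable fun x => f x ^ 2 := hf.pow_const 2
    rw [historyLaw, historyLaw, integral_dirac' _ _ hm0.stronglyMeasurable,
      integral_dirac' _ _ hm1.stronglyMeasurable]
    generalize f Fin.elim0 = c
    have h1 : 0 < 1 + l := by linarith
    simp only [Finset.univ_eq_empty, Finset.sum_empty, mul_zero, sub_zero]
    rw [div_le_iff₀ h1]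
    nlinarith [sq_nonneg ((1 + l) * c - 1)]
  | succ t ih =>
    have ht' : t ≤ T := Nat.le_of_succ_le ht
    have hm0 : Measurable fun x => (1 - f x) ^ 2 := (measurable_const.sub hf).pow_const 2
    have hm1 : Measurable fun x => f x ^ 2 := hf.pow_const 2
    have hb0 : ∀ e, (1 - f e) ^ 2 ∈ Set.Icc (0 : ℝ) 1 := fun e =>
      ⟨sq_nonneg _, by nlinarith [(hf1 e).1, (hf1 e).2]⟩
    have hb1 : ∀ e, f e ^ 2 ∈ Set.Icc (0 : ℝ) 1 := fun e =>
      ⟨sq_nonneg _, by nlinarith [(hf1 e).1, (hf1 e).2]⟩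
    rw [integral_historyLaw_succ A M' _ t ht hm0 hb0, integral_historyLaw_succ A M _ t ht hm1 hb1]
    have hs0 : Measurable fun x => ∫ e, (1 - f (Fin.snoc (α := fun _ => Episode Pol Obs H) x e)) ^ 2
        ∂(A.step M' M'.coinReward t ht x) :=
      (hm0.comp (measurable_snoc t)).stronglyMeasurable.integral_kernel_prod_right'.measurable
    have hs1 : Measurable fun x => ∫ e, f (Fin.snoc (α := fun _ => Episode Pol Obs H) x e) ^ 2
        ∂(A.step M M.coinReward t ht x) :=
      (hm1.comp (measurable_snoc t)).stronglyMeasurable.integral_kernel_prod_right'.measurable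
    have hms : ∀ x, Measurable (Fin.snoc (α := fun _ => Episode Pol Obs H) (n := t) x) := fun x =>
      (measurable_snoc t).comp measurable_prodMk_left
    have hsb0 : ∀ x, ∫ e, (1 - f (Fin.snoc (α := fun _ => Episode Pol Obs H) x e)) ^ 2
        ∂(A.step M' M'.coinReward t ht x) ∈ Set.Icc (0 : ℝ) 1 := fun x =>
      integral_mem_Icc (hm0.comp (hms x)) fun e => hb0 _
    have hsb1 : ∀ x, ∫ e, f (Fin.snoc (α := fun _ => Episode Pol Obs H) x e) ^ 2
        ∂(A.step M M.coinReward t ht x) ∈ Set.Icc (0 : ℝ) 1 := fun x =>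
      integral_mem_Icc (hm1.comp (hms x)) fun e => hb1 _
    set F : (Fin t → Episode Pol Obs H) → ℝ := fun x =>
      √(∫ e, f (Fin.snoc (α := fun _ => Episode Pol Obs H) x e) ^ 2
        ∂(A.step M M.coinReward t ht x)) with hF
    have hF2 : ∀ x, ∫ e, f (Fin.snoc (α := fun _ => Episode Pol Obs H) x e) ^ 2
        ∂(A.step M M.coinReward t ht x) = F x ^ 2 := fun x => (Real.sq_sqrt (hsb1 x).1).symm
    have hF1 : ∀ x, F x ∈ Set.Icc (0 : ℝ) 1 := fun x =>
      ⟨Real.sqrt_nonneg _, Real.sqrt_le_one.2 (hsb1 x).2⟩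
    have hFm : Measurable F := hs1.sqrt
    have hd : Measurable fun x => ∫ π, dRLSq M M' π ∂(A.explore t ht x) :=
      (measurable_dRLSq M M').stronglyMeasurable.integral_kernel.measurable
    have hdi : Integrable (fun x => ∫ π, dRLSq M M' π ∂(A.explore t ht x))
        (A.historyLaw M' M'.coinReward t ht') :=
      integrable_of_bounds hd fun x => integral_mem_Icc (measurable_dRLSq M M') (dRLSq_mem M M')
    have hFi : Integrable (fun x => (1 - F x) ^ 2) (A.historyLaw M' M'.coinReward t ht') :=
      integrable_of_bounds (a := 0) (b := 1) ((measurable_const.sub hFm).pow_const 2) fun x =>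
        ⟨sq_nonneg _, by nlinarith [(hF1 x).1, (hF1 x).2]⟩
    have hpt : ∀ x, (1 - F x) ^ 2 ≤
        ∫ e, (1 - f (Fin.snoc (α := fun _ => Episode Pol Obs H) x e)) ^ 2
          ∂(A.step M' M'.coinReward t ht x)
        + 4 * ∫ π, dRLSq M M' π ∂(A.explore t ht x) := fun x => by
      refine one_sub_sq_le_of_forall_multiplier (hF1 x).1 (hF1 x).2 fun m hm => ?_
      have h := sub_integral_dRLSq_le_step_mixture A M M' t ht x hm (hf.comp (hms x))
        fun e => hf1 _
      simp only [Function.comp_apply, hF2] at h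
      linarith
    have hint := integral_mono hFi ((integrable_of_bounds hs0 hsb0).add (hdi.const_mul 4)) hpt
    rw [integral_add' (integrable_of_bounds hs0 hsb0) (hdi.const_mul 4), integral_const_mul] at hint
    have hpol : ∫ π, dRLSq M M' π ∂(A.policyLaw M' M'.coinReward t ht) =
        ∫ x, ∫ π, dRLSq M M' π ∂(A.explore t ht x) ∂(A.historyLaw M' M'.coinReward t ht') :=
      integral_measureComp (measurable_dRLSq M M') (dRLSq_mem M M')
    have hIH := ih ht' hFm hF1
    simp only [hF2, Fin.sum_univ_castSucc, Fin.val_castSucc, Fin.val_last, hpol]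
    linarith

/-- The case `l = 1` of the mixture bound for the test `(1 + w) / 2` compares the expectations of a
bounded function of the history under the two models. -/
theorem integral_historyLaw_le [MeasurableSpace.CountableOrCountablyGenerated Pol Obs]
    (A : PACAlgorithm Pol Obs H T) (M M' : DMSOModel Pol Obs H)
    {w : (Fin T → Episode Pol Obs H) → ℝ} (hw : Measurable w)
    (hw1 : ∀ x, w x ∈ Set.Icc (0 : ℝ) 1) :
    ∫ x, w x ∂(A.historyLaw M' M'.coinReward T le_rfl) ≤
      3 * ∫ x, w x ∂(A.historyLaw M M.coinReward T le_rfl)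
        + 16 * ∑ s : Fin T, ∫ π, dRLSq M M' π ∂(A.policyLaw M' M'.coinReward s s.2) := by
  have h := sub_sum_dRLSq_le_historyLaw_mixture A M M' zero_le_one T le_rfl
    (f := fun x => (1 + w x) / 2) ((measurable_const.add hw).div_const 2)
    fun x => ⟨by linarith [(hw1 x).1], by linarith [(hw1 x).2]⟩
  have hm0 : Measurable fun x => (1 - (1 + w x) / 2) ^ 2 := by fun_prop
  have hm1 : Measurable fun x => ((1 + w x) / 2) ^ 2 := by fun_prop
  have h0 : ∫ x, (1 - (1 + w x) / 2) ^ 2 ∂(A.historyLaw M' M'.coinReward T le_rfl) ≤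
      1 / 4 - 1 / 4 * ∫ x, w x ∂(A.historyLaw M' M'.coinReward T le_rfl) := by
    have hi := integrable_of_bounds (μ := A.historyLaw M' M'.coinReward T le_rfl) hw hw1
    rw [← integral_const_mul]
    refine (integral_mono (integrable_of_bounds (a := 0) (b := 1) hm0 fun x =>
      ⟨sq_nonneg _, by nlinarith [(hw1 x).1, (hw1 x).2]⟩)
      ((integrable_const (1 / 4)).sub (hi.const_mul (1 / 4))) fun x => ?_).trans_eq ?_
    · have := hw1 x
      simp only [Pi.sub_apply]
      nlinarith [this.1, this.2]
    · rw [integral_sub' (integrable_const _) (hi.const_mul _)]; simp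
  have h1 : ∫ x, ((1 + w x) / 2) ^ 2 ∂(A.historyLaw M M.coinReward T le_rfl) ≤
      1 / 4 + 3 / 4 * ∫ x, w x ∂(A.historyLaw M M.coinReward T le_rfl) := by
    have hi := integrable_of_bounds (μ := A.historyLaw M M.coinReward T le_rfl) hw hw1
    rw [← integral_const_mul]
    refine (integral_mono (integrable_of_bounds (a := 0) (b := 1) hm1 fun x =>
      ⟨sq_nonneg _, by nlinarith [(hw1 x).1, (hw1 x).2]⟩)
      ((integrable_const (1 / 4)).add (hi.const_mul (3 / 4))) fun x => ?_).trans_eq ?_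
    · have := hw1 x
      simp only [Pi.add_apply]
      nlinarith [this.1, this.2]
    · rw [integral_add' (integrable_const _) (hi.const_mul _)]; simp
  linarith

end PACAlgorithm

/-! ### The decision-estimation coefficient -/

namespace PACAlgorithm

open DMSOModel

variable {Pol Obs : Type*} [MeasurableSpace Pol] [MeasurableSpace Obs] {H T : ℕ}

theorem nonempty_policy (A : PACAlgorithm Pol Obs H T) (hT : 1 ≤ T) : Nonempty Pol :=
  nonempty_of_isProbabilityMeasure (A.explore 0 hT Fin.elim0)

/-- The law of the policy executed in an episode chosen uniformly at random. -/
noncomputable def averagePolicyLaw (A : PACAlgorithm Pol Obs H T) (M : DMSOModel Pol Obs H)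
    (R : M.RewardLaw) : Measure Pol :=
  (T : ℝ≥0∞)⁻¹ • ∑ s : Fin T, A.policyLaw M R s s.2

theorem isProbabilityMeasure_averagePolicyLaw (A : PACAlgorithm Pol Obs H T) (hT : 1 ≤ T)
    (M : DMSOModel Pol Obs H) (R : M.RewardLaw) :
    IsProbabilityMeasure (A.averagePolicyLaw M R) := by
  refine ⟨?_⟩
  simp only [averagePolicyLaw, Measure.smul_apply, Measure.finsetSum_apply, measure_univ,
    Finset.sum_const, Finset.card_univ, Fintype.card_fin, nsmul_eq_mul, mul_one, smul_eq_mul]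
  exact ENNReal.inv_mul_cancel (by exact_mod_cast (by omega : T ≠ 0)) (ENNReal.natCast_ne_top T)

theorem integral_averagePolicyLaw (A : PACAlgorithm Pol Obs H T) (M : DMSOModel Pol Obs H)
    (R : M.RewardLaw) {f : Pol → ℝ} {a b : ℝ} (hf : Measurable f) (h : ∀ x, f x ∈ Set.Icc a b) :
    ∫ π, f π ∂(A.averagePolicyLaw M R) =
      (T : ℝ)⁻¹ * ∑ s : Fin T, ∫ π, f π ∂(A.policyLaw M R s s.2) := by
  rw [averagePolicyLaw, integral_smul_measure,
    integral_finsetSum_measure fun s _ => integrable_of_bounds hf h]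
  simp

theorem expectedSubOpt_eq (A : PACAlgorithm Pol Obs H T) (M : DMSOModel Pol Obs H)
    (R : M.RewardLaw) : A.expectedSubOpt M R =
      ∫ x, ∫ π, M.gap π ∂(A.output x) ∂(A.historyLaw M R T le_rfl) := by
  simp only [expectedSubOpt, subOpt_eq_integral_gap]

theorem measurable_integral_gap_output (A : PACAlgorithm Pol Obs H T) (M : DMSOModel Pol Obs H) :
    Measurable fun x => ∫ π, M.gap π ∂(A.output x) :=
  M.measurable_gap.stronglyMeasurable.integral_kernel.measurable

theorem integral_gap_output_mem (A : PACAlgorithm Pol Obs H T) (M : DMSOModel Pol Obs H)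
    (x : Fin T → Episode Pol Obs H) : ∫ π, M.gap π ∂(A.output x) ∈ Set.Icc (0 : ℝ) H :=
  integral_mem_Icc M.measurable_gap M.gap_mem

theorem expectedSubOpt_mem (A : PACAlgorithm Pol Obs H T) (M : DMSOModel Pol Obs H)
    (R : M.RewardLaw) : A.expectedSubOpt M R ∈ Set.Icc (0 : ℝ) H := by
  rw [expectedSubOpt_eq]
  exact integral_mem_Icc (A.measurable_integral_gap_output M) (A.integral_gap_output_mem M)

end PACAlgorithm

namespace DMSOModel

variable {Pol Obs : Type*} [MeasurableSpace Pol] [MeasurableSpace Obs] {H T : ℕ}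

theorem two_pow_mul_log_two_le_logFactor [Nonempty Pol] {𝓜 : Set (DMSOModel Pol Obs H)}
    {M : DMSOModel Pol Obs H} (hM : M ∈ 𝓜) (hT : 1 ≤ T) :
    2 ^ 13 * Real.log 2 ≤ logFactor 𝓜 T := by
  have hV : 3 ≤ ratioBound 𝓜 := by
    obtain ⟨π⟩ := ‹Nonempty Pol›
    have h1 : (1 : ℝ≥0∞) ≤ ⨆ (M ∈ 𝓜) (M' ∈ 𝓜) (π : Pol) (A : Set Obs) (_ : MeasurableSet A),
        M.obs π A / M'.obs π A := by
      refine le_iSup₂_of_le M hM (le_iSup₂_of_le M hM (le_iSup_of_le π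
        (le_iSup₂_of_le Set.univ MeasurableSet.univ ?_)))
      simp
    calc (3 : ℝ≥0∞) = 3 * 1 := (mul_one _).symm
      _ ≤ _ := mul_le_mul_right h1 3
  have hmin : (2 : ℝ≥0∞) ≤ min (2 * (T : ℝ≥0∞)) (ratioBound 𝓜) := by
    refine le_min ?_ (le_trans (by norm_num) hV)
    exact_mod_cast (by omega : 2 ≤ 2 * T)
  have hfin : min (2 * (T : ℝ≥0∞)) (ratioBound 𝓜) ≠ ∞ :=
    ne_top_of_le_ne_top (ENNReal.mul_ne_top (by simp) (by simp)) (min_le_left _ _)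
  have h2 : (2 : ℝ) ≤ (min (2 * (T : ℝ≥0∞)) (ratioBound 𝓜)).toReal := by
    simpa using ENNReal.toReal_mono hfin hmin
  unfold logFactor
  gcongr

end DMSOModel

namespace PACAlgorithm

open DMSOModel

variable {Pol Obs : Type*} [MeasurableSpace Pol] [MeasurableSpace Obs] {H T : ℕ}

/-- If the gaps of `M` and `M'` differ by at most `ε` and the suboptimality for `M` of the output
under `M'` exceeds by `Δ` the cost `C ε ∑ E[dRLSq M M']` of discriminating the two models, then the
algorithm is at least `Δ / 5`-suboptimal under `M` or under `M'`. The function of the history that is compared under the two models is the positive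
part of the difference of the suboptimalities: it has range `[0, ε]`, so the error of the
comparison is scaled by `ε`. -/
theorem le_expectedSubOpt_or [MeasurableSpace.CountableOrCountablyGenerated Pol Obs]
    (A : PACAlgorithm Pol Obs H T) (M M' : DMSOModel Pol Obs H) {ε Δ C : ℝ} (hε : 0 < ε)
    (hC : 16 ≤ C) (hgap : ∀ π, |M.gap π - M'.gap π| ≤ ε)
    (h : Δ + C * ε * ∑ s : Fin T, ∫ π, dRLSq M M' π ∂(A.policyLaw M' M'.coinReward s s.2) ≤
      ∫ x, ∫ π, M.gap π ∂(A.output x) ∂(A.historyLaw M' M'.coinReward T le_rfl)) :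
    Δ / 5 ≤ A.expectedSubOpt M M.coinReward ∨ Δ / 5 ≤ A.expectedSubOpt M' M'.coinReward := by
  by_contra! hlt
  obtain ⟨hM, hM'⟩ := hlt
  set S := ∑ s : Fin T, ∫ π, dRLSq M M' π ∂(A.policyLaw M' M'.coinReward s s.2)
  have hS : 0 ≤ S := Finset.sum_nonneg fun s _ => integral_nonneg fun π => (dRLSq_mem M M' π).1
  rw [expectedSubOpt_eq] at hM hM'
  set X : (Fin T → Episode Pol Obs H) → ℝ := fun x => ∫ π, M.gap π ∂(A.output x)
  set Y : (Fin T → Episode Pol Obs H) → ℝ := fun x => ∫ π, M'.gap π ∂(A.output x)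
  have hXm : Measurable X := A.measurable_integral_gap_output M
  have hYm : Measurable Y := A.measurable_integral_gap_output M'
  have hX : ∀ x, X x ∈ Set.Icc (0 : ℝ) H := A.integral_gap_output_mem M
  have hY : ∀ x, Y x ∈ Set.Icc (0 : ℝ) H := A.integral_gap_output_mem M'
  have hXY : ∀ x, X x - Y x ≤ ε := fun x => by
    have i1 := integrable_of_bounds (μ := A.output x) M.measurable_gap M.gap_mem
    have i2 := integrable_of_bounds (μ := A.output x) M'.measurable_gap M'.gap_mem
    have := integral_mono (i1.sub i2) (integrable_const ε) fun π =>
      (le_abs_self _).trans (hgap π)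
    rw [integral_sub' i1 i2] at this
    simpa using this
  set W : (Fin T → Episode Pol Obs H) → ℝ := fun x => max 0 (X x - Y x)
  have hWm : Measurable W := measurable_const.max (hXm.sub hYm)
  have hW : ∀ x, W x ∈ Set.Icc (0 : ℝ) ε := fun x =>
    ⟨le_max_left _ _, max_le hε.le (hXY x)⟩
  have hcmp := A.integral_historyLaw_le M M' (w := fun x => W x / ε) (hWm.div_const ε)
    fun x => ⟨div_nonneg (hW x).1 hε.le, (div_le_one hε).2 (hW x).2⟩
  rw [integral_div, integral_div, ← mul_div_assoc, div_add' _ _ _ hε.ne',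
    div_le_div_iff_of_pos_right hε] at hcmp
  have hlow : ∫ x, X x ∂(A.historyLaw M' M'.coinReward T le_rfl) ≤
      ∫ x, Y x ∂(A.historyLaw M' M'.coinReward T le_rfl)
        + ∫ x, W x ∂(A.historyLaw M' M'.coinReward T le_rfl) := by
    have iY := integrable_of_bounds (μ := A.historyLaw M' M'.coinReward T le_rfl) hYm hY
    have iW := integrable_of_bounds (μ := A.historyLaw M' M'.coinReward T le_rfl) hWm hW
    rw [← integral_add iY iW]
    refine integral_mono (integrable_of_bounds hXm hX) (iY.add iW) fun x => ?_
    have : X x - Y x ≤ W x := le_max_right _ _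
    linarith
  have hup : ∫ x, W x ∂(A.historyLaw M M.coinReward T le_rfl) ≤
      ∫ x, X x ∂(A.historyLaw M M.coinReward T le_rfl) :=
    integral_mono (integrable_of_bounds hWm hW) (integrable_of_bounds hXm hX) fun x =>
      max_le (hX x).1 (by linarith [(hY x).1])
  have hX0 : 0 ≤ ∫ x, X x ∂(A.historyLaw M M.coinReward T le_rfl) :=
    integral_nonneg fun x => (hX x).1
  have hcost : 16 * S * ε ≤ C * ε * S := by
    nlinarith [mul_nonneg (sub_nonneg.2 hC) (mul_nonneg hε.le hS)]
  linarith

theorem exists_le_expectedSubOpt_of_lt_edec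
    [MeasurableSpace.CountableOrCountablyGenerated Pol Obs] (A : PACAlgorithm Pol Obs H T)
    (hT : 1 ≤ T) {𝓜 : Set (DMSOModel Pol Obs H)} {M' : DMSOModel Pol Obs H} (hM' : M' ∈ 𝓜)
    {γ Δ : ℝ} (hγ : 0 < γ)
    (h : (Δ : EReal) < edec γ (localized 𝓜 (radius 𝓜 T γ) M') M') :
    ∃ M ∈ 𝓜, Δ / 5 ≤ A.expectedSubOpt M M.coinReward := by
  have := A.nonempty_policy hT
  have hC : 16 ≤ logFactor 𝓜 T := by
    have := two_pow_mul_log_two_le_logFactor hM' hT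
    linarith [Real.log_two_gt_d9]
  have hT0 : (0 : ℝ) < T := by exact_mod_cast hT
  have := A.isProbabilityMeasure_averagePolicyLaw hT M' M'.coinReward
  have hlt := h.trans_le (iInf₂_le
    (⟨A.averagePolicyLaw M' M'.coinReward, inferInstance⟩ : ProbabilityMeasure Pol)
    (⟨A.output ∘ₘ A.historyLaw M' M'.coinReward T le_rfl, inferInstance⟩ :
      ProbabilityMeasure Pol))
  obtain ⟨M, hM⟩ := lt_iSup_iff.1 hlt
  obtain ⟨hMloc, hM⟩ := lt_iSup_iff.1 hM
  rw [EReal.coe_lt_coe_iff] at hM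
  simp only [ProbabilityMeasure.coe_mk] at hM
  rw [integral_measureComp M.measurable_gap M.gap_mem,
    integral_averagePolicyLaw A M' _ (measurable_dRLSq M M') (dRLSq_mem M M')] at hM
  have hscale : logFactor 𝓜 T * radius 𝓜 T γ = γ * (T : ℝ)⁻¹ := by
    unfold radius
    have : logFactor 𝓜 T ≠ 0 := by linarith
    field_simp
  have hradius : 0 < radius 𝓜 T γ := div_pos hγ (mul_pos (by linarith) hT0)
  rcases A.le_expectedSubOpt_or M M' (Δ := Δ) hradius hC hMloc.2
    (by rw [hscale, mul_assoc]; linarith) with h1 | h1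
  · exact ⟨M, hMloc.1, h1⟩
  · exact ⟨M', hM', h1⟩

end PACAlgorithm

open DMSOModel in
theorem proposition5 {Pol Obs : Type*} [MeasurableSpace Pol] [MeasurableSpace Obs]
    [MeasurableSpace.CountableOrCountablyGenerated Pol Obs] {H : ℕ}
    (𝓜 : Set (DMSOModel Pol Obs H)) (h𝓜 : 𝓜.Nonempty) (T : ℕ) (hT : 1 ≤ T) :
    ∃ R : (M : 𝓜) → RewardLaw (M : DMSOModel Pol Obs H),
      (∀ (M : 𝓜) (o : Obs), ∀ᵐ r ∂((R M).kernel o), ∀ h, r h ∈ Set.Icc (-2 : ℝ) 2) ∧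
      ∀ A : PACAlgorithm Pol Obs H T, ∃ M : 𝓜,
        ((1 / 6 : ℝ) : EReal) *
            (⨆ (γ : ℝ) (_ : 0 < γ), ⨆ M' ∈ 𝓜, edec γ (localized 𝓜 (radius 𝓜 T γ) M') M') ≤
          ((A.expectedSubOpt M (R M) : ℝ) : EReal) := by
  refine ⟨fun M => M.1.coinReward, fun M => M.1.coinReward_mem, fun A => ?_⟩
  set E : EReal := ⨆ (γ : ℝ) (_ : 0 < γ), ⨆ M' ∈ 𝓜, edec γ (localized 𝓜 (radius 𝓜 T γ) M') M'
  have key : ∀ Δ : ℝ, (Δ : EReal) < E → ∃ M ∈ 𝓜, Δ / 5 ≤ A.expectedSubOpt M M.coinReward := by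
    intro Δ hΔ
    obtain ⟨γ, hΔ⟩ := lt_iSup_iff.1 hΔ
    obtain ⟨hγ, hΔ⟩ := lt_iSup_iff.1 hΔ
    obtain ⟨M', hΔ⟩ := lt_iSup_iff.1 hΔ
    obtain ⟨hM', hΔ⟩ := lt_iSup_iff.1 hΔ
    exact A.exists_le_expectedSubOpt_of_lt_edec hT hM' hγ hΔ
  obtain ⟨M₀, hM₀⟩ := h𝓜
  have h6 : (0 : ℝ) < 1 / 6 := by norm_num
  clear_value E
  induction E with
  | bot =>
    refine ⟨⟨M₀, hM₀⟩, ?_⟩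
    rw [EReal.coe_mul_bot_of_pos h6]
    exact bot_le
  | top =>
    obtain ⟨M, -, h⟩ := key (5 * (H + 1)) (EReal.coe_lt_top _)
    linarith [(A.expectedSubOpt_mem M M.coinReward).2]
  | coe e =>
    -- `key` has the constant `1 / 5` instead of `1 / 6`, so a value below the supremum suffices.
    rcases le_or_gt e 0 with he | he
    · refine ⟨⟨M₀, hM₀⟩, ?_⟩
      rw [← EReal.coe_mul, EReal.coe_le_coe_iff]
      linarith [(A.expectedSubOpt_mem M₀ M₀.coinReward).1]
    · obtain ⟨M, hM, h⟩ := key (5 / 6 * e) (EReal.coe_lt_coe_iff.2 (by linarith))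
      refine ⟨⟨M, hM⟩, ?_⟩
      rw [← EReal.coe_mul, EReal.coe_le_coe_iff]
      linarith
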